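/- Let $(W,\mathcal S)$ be a finite Coxeter system acting faithfully as a reflection group on a Euclidean space $V$ of dimension $|\mathcal S|$. Let $\Phi=\Phi^+\sqcup\Phi^-$ be a root system for $(W,\mathcal S)$ in $V$ whose simple roots $\alpha_s$ ($s\in\mathcal S$) form a basis of $V$, so that $\Phi=\{u(\alpha_s): u\in W,\ s\in\mathcal S\}$ and each $s\in\mathcal S$ acts as the orthogonal reflection in $\alpha_s$. Here $\Phi\cap\mathbb R\beta=\{\pm\beta\}$ for $\beta\in\Phi$, the positive roots are the roots that are non-negative combinations of simple roots, and $\Phi^-=-\Phi^+$; the root system need not be crystallographic. For $\beta\in\Phi^+$ let $s_\beta\in W$ be the reflection in $\beta$. Let $\ell$ be the length function, $\le$ the Bruhat order (with covers $x\prec rx$ for reflections $r$ with $\ell(rx)=\ell(x)+1$) and $\le_{\mathsf R}$ the right weak order (with covers $x\prec_{\mathsf R} xs$ for $s\in\mathcal S$ with $\ell(xs)=\ell(x)+1$). For $x,y\in W$ put $$E^+(x,y)=\{\beta\in\Phi^+ : x\prec s_\beta x\le y\}.$$ Let $Q=s_1\cdots s_m$ be a word in $\mathcal S$, not necessarily reduced.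 For $X\subseteq\{1,\dots,m\}$ let $Q_X$ be the subword of the letters at the positions in $X$ and $\Pi Q_X\in W$ the product of these letters in order. The Demazure product $\mathrm{Dem}(s_1\cdots s_m)$ is obtained by scanning the word from left to right, starting with $x=e$, and replacing $x$ by $xs_k$ whenever $x(\alpha_{s_k})\in\Phi^+$. For $w\in W$ the subword complex $\mathcal{SC}(Q,w)$ consists of all $I\subseteq\{1,\dots,m\}$ such that $Q_{\{1,\dots,m\}\setminus I}$ contains a reduced word for $w$ as a subword; its facets are its inclusion-maximal elements. The root function is $\mathsf r(I,k)=\Pi Q_{\{1,\dots,k-1\}\setminus I}(\alpha_{s_k})$. Given a linear functional $f:V\to\mathbb R$, define $I_f\subseteq\{1,\dots,m\}$ by the following algorithm. Start with $w_0=e$ and $I_0=\emptyset$. For $k=1,\dots,m$ put $\beta_k=w_{k-1}(\alpha_{s_k})$ and determine which of the following conditions holds: - (1) $f(\beta_k)\ge 0$, $\beta_k\in\Phi^+$ and $w_{k-1}s_k\not\le_{\mathsf R}w$; - (2) $f(\beta_k)\ge 0$ and $\beta_k\notin\Phi^+$; - (3) $f(\beta_k)>0$, $\beta_k\in\Phi^+$,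 $w_{k-1}s_k\le_{\mathsf R}w$ and $w_{k-1}^{-1}w\le\mathrm{Dem}(s_{k+1}\cdots s_m)$; - (4) $f(\beta_k)<0$; - (5) $f(\beta_k)=0$, $\beta_k\in\Phi^+$ and $w_{k-1}s_k\le_{\mathsf R}w$; - (6) $f(\beta_k)>0$, $\beta_k\in\Phi^+$, $w_{k-1}s_k\le_{\mathsf R}w$ and $w_{k-1}^{-1}w\not\le\mathrm{Dem}(s_{k+1}\cdots s_m)$. In cases (1), (2), (3) set $I_k=I_{k-1}\cup\{k\}$ and $w_k=w_{k-1}$; in cases (4), (5), (6) set $I_k=I_{k-1}$ and $w_k=w_{k-1}s_k$. Finally $I_f=I_m$. **Theorem.** Let $\mathcal{SC}(Q,w)$ be non-empty, and let $f:V\to\mathbb R$ be a linear functional with $f(\beta)\ge 0$ for all $\beta\in E^+(w,\mathrm{Dem}(Q))$. Then: - (a) $I_f$ is a facet of $\mathcal{SC}(Q,w)$, i.e., $Q_{\{1,\dots,m\}\setminus I_f}$ is a reduced word for $w$. - (b) For every $i\in I_f$, we have $f(\mathsf r(I_f,i))\ge 0$. - (c) For every $i\in I_f$ with $f(\mathsf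 r(I_f,i))=0$ and $\mathsf r(I_f,i)\notin E^+(w,\mathrm{Dem}(Q))$, we have $\mathsf r(I_f,i)\in\Phi^-$. -/

import Mathlib

open scoped InnerProductSpace

/-- A root system for the Coxeter system `cs` in the Euclidean space `V`: the group `W` acts
faithfully on `V` by isometries, the simple roots form a basis of `V`, and the generator
`cs.simple i` acts as the orthogonal reflection in the simple root `α i`. The roots are the
vectors `w (α i)`; the only multiples of a root that are roots are the root and its negative,
and the `α i` form a simple system, that is, the coordinates of every root with respect to them
are all nonnegative or all nonpositive. No integrality is required. -/
structure CoxeterRootSystem {B W : Type*} [Group W] {M : CoxeterMatrix B}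
    (cs : CoxeterSystem M W) (V : Type*) [NormedAddCommGroup V] [InnerProductSpace ℝ V] where
  /-- the action of `W` on `V` -/
  act : W →* (V ≃ₗᵢ[ℝ] V)
  act_injective : Function.Injective act
  /-- the simple roots -/
  α : Module.Basis B ℝ V
  act_simple : ∀ i : B, act (cs.simple i) = (ℝ ∙ (α i))ᗮ.reflection
  reduced : ∀ (w w' : W) (i j : B) (c : ℝ),
    act w (α i) = c • act w' (α j) → c = 1 ∨ c = -1
  nonneg_or_nonpos : ∀ (w : W) (i : B),
    (∀ j, 0 ≤ α.repr (act w (α i)) j) ∨ (∀ j, α.repr (act w (α i)) j ≤ 0)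

namespace CoxeterSystem

variable {B W : Type*} [Group W] {M : CoxeterMatrix B} (cs : CoxeterSystem M W)

/-- Cover relation of the Bruhat order: `y = t x` for a reflection `t`, one longer than `x`. -/
def BruhatCover (x y : W) : Prop :=
  ∃ t : W, cs.IsReflection t ∧ y = t * x ∧ cs.length y = cs.length x + 1

/-- The Bruhat order. -/
def BruhatLE : W → W → Prop := Relation.ReflTransGen cs.BruhatCover

/-- Cover relation of the right weak order: `y = x s` for a simple `s`, one longer than `x`. -/
def RightWeakCover (x y : W) : Prop :=
  ∃ i : B, y = x * cs.simple i ∧ cs.length y = cs.length x + 1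

/-- The right weak order. -/
def RightWeakLE : W → W → Prop := Relation.ReflTransGen cs.RightWeakCover

end CoxeterSystem

/-- The subword of `Q` consisting of the letters at the positions in `X`, in order. -/
def subword {B : Type*} {m : ℕ} (Q : Fin m → B) (X : Finset (Fin m)) : List B :=
  ((List.finRange m).filter (fun k => k ∈ X)).map Q

namespace CoxeterSystem

variable {B W : Type*} [Group W] {M : CoxeterMatrix B} (cs : CoxeterSystem M W)

/-- The subword complex `SC(Q, w)`: the (down-closed) family of all sets of positions in `Q`
whose complement contains a reduced word for `w`. -/
def subwordComplex {m : ℕ} (Q : Fin m → B) (w : W) : LowerSet (Finset (Fin m)) where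
  carrier := {I | ∃ X : Finset (Fin m), X ⊆ Iᶜ ∧
    cs.IsReduced (subword Q X) ∧ cs.wordProd (subword Q X) = w}
  lower' := by
    rintro I J hJI ⟨X, hX, h⟩
    exact ⟨X, hX.trans (Finset.compl_subset_compl.mpr hJI), h⟩

/-- The facets of `SC(Q, w)` are its inclusion-maximal faces. -/
def IsSubwordFacet {m : ℕ} (Q : Fin m → B) (w : W) (I : Finset (Fin m)) : Prop :=
  Maximal (fun J => J ∈ cs.subwordComplex Q w) I

end CoxeterSystem

namespace CoxeterRootSystem

variable {B W : Type*} [Group W] {M : CoxeterMatrix B} {cs : CoxeterSystem M W}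
  {V : Type*} [NormedAddCommGroup V] [InnerProductSpace ℝ V] (R : CoxeterRootSystem cs V)

/-- The set `Φ` of roots. -/
def roots : Set V := {β | ∃ (w : W) (i : B), β = R.act w (R.α i)}

/-- The set `Φ⁺` of positive roots. -/
def posRoots : Set V := {β | β ∈ R.roots ∧ ∀ i, 0 ≤ R.α.repr β i}

/-- The set `Φ⁻ = -Φ⁺` of negative roots. -/
def negRoots : Set V := {β | -β ∈ R.posRoots}

/-- The group element `r` is the reflection `s_β`, for a root `β`. -/
def IsReflectionIn (r : W) (β : V) : Prop := R.act r = (ℝ ∙ β)ᗮ.reflection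

/-- `E⁺(x, y)`: the positive roots `β` such that `s_β x` covers `x` in the Bruhat order and
`s_β x ≤ y`. -/
def Eplus (x y : W) : Set V :=
  {β | β ∈ R.posRoots ∧ ∃ r : W, R.IsReflectionIn r β ∧
    cs.BruhatCover x (r * x) ∧ cs.BruhatLE (r * x) y}

open Classical in
/-- The Demazure product of a word: scan from left to right, starting at the identity, and
replace `x` by `x s` whenever `x (α_s)` is a positive root. -/
noncomputable def demazure (Q : List B) : W :=
  Q.foldl (fun x i => if R.act x (R.α i) ∈ R.posRoots then x * cs.simple i else x) 1

/-- The root function `r(I, k)`: the product of the letters at the positions before `k` that are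
not in `I`, applied to the simple root of the letter at position `k`. -/
noncomputable def rootFn {m : ℕ} (Q : Fin m → B) (I : Finset (Fin m)) (k : Fin m) : V :=
  R.act (cs.wordProd (subword Q (Finset.Iio k \ I))) (R.α (Q k))

open Classical in
/-- The decision tree: which of the conditions 1, …, 6 holds at position `k`, where `x` is the
current group element. -/
noncomputable def antigreedyCondition {m : ℕ} (Q : Fin m → B) (w : W) (f : V →ₗ[ℝ] ℝ)
    (x : W) (k : Fin m) : ℕ :=
  let β := R.act x (R.α (Q k))
  if f β < 0 then 4
  else if f β = 0 then
    if β ∈ R.posRoots then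
      if cs.RightWeakLE (x * cs.simple (Q k)) w then 5 else 1
    else 2
  else
    if β ∈ R.posRoots then
      if cs.RightWeakLE (x * cs.simple (Q k)) w then
        if cs.BruhatLE (x⁻¹ * w) (R.demazure (subword Q (Finset.Ioi k))) then 3 else 6
      else 1
    else 2

/-- One pass through the loop: the state is the current group element and the current set of
positions. In conditions 1, 2, 3 the position `k` is added to the set; in conditions 4, 5, 6 the
group element is multiplied by the letter at position `k`. -/
noncomputable def antigreedyStep {m : ℕ} (Q : Fin m → B) (w : W) (f : V →ₗ[ℝ] ℝ)
    (S : W × Finset (Fin m)) (k : Fin m) : W × Finset (Fin m) :=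
  let c := R.antigreedyCondition Q w f S.1 k
  if c = 1 ∨ c = 2 ∨ c = 3 then (S.1, insert k S.2) else (S.1 * cs.simple (Q k), S.2)

/-- The output `I_f` of the algorithm: the set obtained from the state `(1, ∅)` after passing
through all positions from left to right. -/
noncomputable def antigreedyFacet {m : ℕ} (Q : Fin m → B) (w : W) (f : V →ₗ[ℝ] ℝ) :
    Finset (Fin m) :=
  ((List.finRange m).foldl (R.antigreedyStep Q w f) (1, ∅)).2

end CoxeterRootSystem

/-! Write `w = x u`, where `x` is the current element of the scan, and let `D` be the Demazure
product of the unread suffix. Three things persist: lengths add in `w = x u`, `u ≤ D`, and every `x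
β` with `β ∈ E⁺(u, D)` satisfies `P`: `f ≥ 0`, and a zero of `f` lies in the original `E⁺(w,
Dem(Q))` or in `Φ⁻`. At the start this is the hypothesis on `f`; at the end `D = 1` forces `u = 1`,
so the used letters spell a reduced word for `w`.

Let `s` be the next letter and `y` the Demazure product of the rest, so that `D` is the longer of
`y` and `s y`. If `s u > u`, then `α_s ∈ E⁺(u, D)`, so `f(x α_s) ≥ 0` and condition 4 cannot occur.
Hence the six conditions collapse (`antigreedyStep_eq`): the letter is used exactly when `s u < u`
and either `f(x α_s) ≤ 0` or `u ≰ y`.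

After a skip, `E⁺(u, y) ⊆ E⁺(u, D)`, and the new root function value `x α_s` either comes from
`E⁺(u, D)` or has `f > 0`. After a use, `s` maps `E⁺(s u, y)` without `α_s` into `E⁺(u, D)`
(`act_simple_mem_Eplus`). The root `α_s` itself occurs only if `u ≤ y`; then `f(x α_s) ≤ 0`, so the
relevant vector `-x α_s` is a negative root with `f ≥ 0`. The Bruhat facts needed all follow from
strong exchange. -/

theorem reflection_orthogonal_span_singleton_apply {V : Type*} [NormedAddCommGroup V]
    [InnerProductSpace ℝ V] (β v : V) :
    (ℝ ∙ β)ᗮ.reflection v = v - (2 * (⟪β, v⟫_ℝ / ‖β‖ ^ 2)) • β := by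
  rw [Submodule.reflection_orthogonal_apply, Submodule.reflection_singleton_apply]
  simp only [RCLike.ofReal_real_eq_id, id, neg_sub, two_smul, two_mul, add_smul]

/-! ### Roots, lengths and strong exchange -/

namespace CoxeterRootSystem

variable {B W : Type*} [Group W] {M : CoxeterMatrix B} {cs : CoxeterSystem M W}
  {V : Type*} [NormedAddCommGroup V] [InnerProductSpace ℝ V] (R : CoxeterRootSystem cs V)

theorem act_mul_apply (x y : W) (v : V) : R.act (x * y) v = R.act x (R.act y v) := by
  rw [map_mul]; rfl

theorem act_one_apply (v : V) : R.act 1 v = v := by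
  rw [map_one]; rfl

theorem act_inv_act (x : W) (v : V) : R.act x⁻¹ (R.act x v) = v := by
  rw [← act_mul_apply, inv_mul_cancel, act_one_apply]

theorem act_simple_apply (i : B) (v : V) :
    R.act (cs.simple i) v = v - (2 * (⟪R.α i, v⟫_ℝ / ‖R.α i‖ ^ 2)) • R.α i := by
  rw [R.act_simple, reflection_orthogonal_span_singleton_apply]

theorem act_simple_self (i : B) : R.act (cs.simple i) (R.α i) = -R.α i := by
  rw [R.act_simple, Submodule.reflection_orthogonalComplement_singleton_eq_neg]

theorem act_mem_roots (x : W) {β : V} (h : β ∈ R.roots) : R.act x β ∈ R.roots := by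
  obtain ⟨w, i, rfl⟩ := h
  exact ⟨x * w, i, by rw [act_mul_apply]⟩

theorem simple_mem_roots (i : B) : R.α i ∈ R.roots := ⟨1, i, by rw [act_one_apply]⟩

theorem neg_mem_roots {β : V} (h : β ∈ R.roots) : -β ∈ R.roots := by
  obtain ⟨w, i, rfl⟩ := h
  exact ⟨w * cs.simple i, i, by rw [act_mul_apply, act_simple_self, map_neg]⟩

theorem simple_mem_posRoots (i : B) : R.α i ∈ R.posRoots := by
  classical
  refine ⟨R.simple_mem_roots i, fun j => ?_⟩
  rw [R.α.repr_self, Finsupp.single_apply]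
  split_ifs <;> norm_num

theorem posRoots_or_neg {β : V} (h : β ∈ R.roots) : β ∈ R.posRoots ∨ -β ∈ R.posRoots := by
  have h' := h
  obtain ⟨w, i, rfl⟩ := h'
  rcases R.nonneg_or_nonpos w i with hp | hn
  · exact Or.inl ⟨h, hp⟩
  · exact Or.inr ⟨R.neg_mem_roots h, fun j => by simpa using hn j⟩

theorem ne_zero_of_mem_roots {β : V} (h : β ∈ R.roots) : β ≠ 0 := by
  obtain ⟨w, i, rfl⟩ := h
  simpa using R.α.ne_zero i

theorem neg_notMem_posRoots {β : V} (h : β ∈ R.posRoots) : -β ∉ R.posRoots := by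
  intro h'
  refine R.ne_zero_of_mem_roots h.1 (R.α.ext_elem fun j => le_antisymm ?_ ?_)
  · simpa using h'.2 j
  · simpa using h.2 j

/-- A simple reflection permutes the positive roots other than its own simple root. -/
theorem act_simple_mem_posRoots {β : V} (h : β ∈ R.posRoots) {i : B} (hne : β ≠ R.α i) :
    R.act (cs.simple i) β ∈ R.posRoots := by
  classical
  -- The reflection changes only the `i`-th coordinate, so one positive coordinate elsewhere decides
  -- the sign of the image.
  have hex : ∃ j, j ≠ i ∧ 0 < R.α.repr β j := by
    by_contra! hcon
    have hβ : β = R.α.repr β i • R.α i := by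
      refine R.α.ext_elem fun j => ?_
      rcases eq_or_ne j i with rfl | hj
      · simp
      · simp [hj.symm, le_antisymm (hcon j hj) (h.2 j)]
    obtain ⟨w, k, hw⟩ := h.1
    have := R.reduced w 1 k i (R.α.repr β i) (by rw [← hw, act_one_apply]; exact hβ)
    rcases this with h1 | h1
    · rw [h1, one_smul] at hβ; exact hne hβ
    · have := h.2 i; linarith
  obtain ⟨j, hj, hpos⟩ := hex
  rcases R.posRoots_or_neg (R.act_mem_roots (cs.simple i) h.1) with h1 | h1
  · exact h1
  · have := h1.2 j
    rw [act_simple_apply] at this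
    simp [hj.symm] at this
    linarith

variable {R} in
theorem IsReflectionIn.conj {r : W} {β : V} (h : R.IsReflectionIn r β) (x : W) :
    R.IsReflectionIn (x * r * x⁻¹) (R.act x β) := by
  unfold IsReflectionIn at *
  ext v
  have hinner : ⟪R.act x β, v⟫_ℝ = ⟪β, R.act x⁻¹ v⟫_ℝ := by
    rw [← (R.act x⁻¹).inner_map_map, act_inv_act]
  have hv : R.act x (R.act x⁻¹ v) = v := by
    simpa only [inv_inv] using R.act_inv_act x⁻¹ v
  rw [act_mul_apply, act_mul_apply, h, reflection_orthogonal_span_singleton_apply,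
    reflection_orthogonal_span_singleton_apply, map_sub, map_smul, hinner, hv,
    LinearIsometryEquiv.norm_map]

theorem isReflectionIn_simple (i : B) : R.IsReflectionIn (cs.simple i) (R.α i) := R.act_simple i

variable {R} in
theorem IsReflectionIn.neg {r : W} {β : V} (h : R.IsReflectionIn r β) :
    R.IsReflectionIn r (-β) := by
  unfold IsReflectionIn at *
  ext v
  rw [h, reflection_orthogonal_span_singleton_apply, reflection_orthogonal_span_singleton_apply,
    inner_neg_left, norm_neg, smul_neg, ← neg_smul]
  congr 2
  ring

variable {R} in
theorem IsReflectionIn.act_self {r : W} {β : V} (h : R.IsReflectionIn r β) :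
    R.act r β = -β := by
  rw [h, Submodule.reflection_orthogonalComplement_singleton_eq_neg]

variable {R} in
theorem IsReflectionIn.unique {r r' : W} {β : V} (h : R.IsReflectionIn r β)
    (h' : R.IsReflectionIn r' β) : r = r' :=
  R.act_injective (h.trans h'.symm)

variable {R} in
theorem IsReflectionIn.isReflection {r : W} {β : V} (h : R.IsReflectionIn r β)
    (hβ : β ∈ R.roots) : cs.IsReflection r := by
  obtain ⟨w, i, rfl⟩ := hβ
  exact ⟨w, i, h.unique ((R.isReflectionIn_simple i).conj w)⟩

theorem exists_posRoot_of_isReflection {t : W} (ht : cs.IsReflection t) :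
    ∃ β ∈ R.posRoots, R.IsReflectionIn t β := by
  obtain ⟨w, i, rfl⟩ := ht
  have h := (R.isReflectionIn_simple i).conj w
  rcases R.posRoots_or_neg (R.act_mem_roots w (R.simple_mem_roots i)) with h1 | h1
  · exact ⟨_, h1, h⟩
  · exact ⟨_, h1, h.neg⟩

/-- If the inverse of a product of simple reflections makes a positive root negative, then the
reflection in this root deletes a letter. -/
theorem exists_eraseIdx_of_act_inv_neg (ω : List B) {β : V} (hβ : β ∈ R.posRoots) {t : W}
    (ht : R.IsReflectionIn t β) (hneg : -R.act (cs.wordProd ω)⁻¹ β ∈ R.posRoots) :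
    ∃ j < ω.length, t * cs.wordProd ω = cs.wordProd (ω.eraseIdx j) := by
  induction ω generalizing β t with
  | nil =>
    rw [cs.wordProd_nil, inv_one, act_one_apply] at hneg
    exact absurd hneg (R.neg_notMem_posRoots hβ)
  | cons i ω ih =>
    -- Follow the root through the letters: it can turn negative only at a letter whose simple root
    -- it equals, and there the reflection cancels that letter.
    by_cases hi : β = R.α i
    · subst hi
      refine ⟨0, by simp, ?_⟩
      rw [ht.unique (R.isReflectionIn_simple i), cs.wordProd_cons, List.eraseIdx_cons_zero,
        cs.simple_mul_simple_cancel_left]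
    · have h1 := ht.conj (cs.simple i)
      rw [cs.wordProd_cons, mul_inv_rev, cs.inv_simple, act_mul_apply] at hneg
      obtain ⟨j, hj, h⟩ := ih (R.act_simple_mem_posRoots hβ hi) h1 hneg
      refine ⟨j + 1, by simpa using hj, ?_⟩
      rw [List.eraseIdx_cons_succ, cs.wordProd_cons, cs.wordProd_cons, ← h, cs.inv_simple]
      simp only [mul_assoc, cs.simple_mul_simple_cancel_left]

theorem length_mul_lt_of_act_inv_neg {w t : W} {β : V} (hβ : β ∈ R.posRoots)
    (ht : R.IsReflectionIn t β) (hneg : -R.act w⁻¹ β ∈ R.posRoots) :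
    cs.length (t * w) < cs.length w := by
  obtain ⟨ω, hω, rfl⟩ := cs.exists_isReduced w
  obtain ⟨j, hj, h⟩ := R.exists_eraseIdx_of_act_inv_neg ω hβ ht hneg
  rw [h, hω.eq]
  have := cs.length_wordProd_le (ω.eraseIdx j)
  rw [List.length_eraseIdx_of_lt hj] at this
  omega

/-- This is the negative case applied to `t * w`, since `t` negates `β`. -/
theorem length_lt_of_act_inv_pos {w t : W} {β : V} (hβ : β ∈ R.posRoots)
    (ht : R.IsReflectionIn t β) (hpos : R.act w⁻¹ β ∈ R.posRoots) :
    cs.length w < cs.length (t * w) := by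
  have hr := ht.isReflection hβ.1
  have := R.length_mul_lt_of_act_inv_neg (w := t * w) hβ ht (by
    rw [mul_inv_rev, hr.inv, act_mul_apply, ht.act_self, map_neg, neg_neg]; exact hpos)
  rwa [← mul_assoc, hr.mul_self, one_mul] at this

theorem act_simple_mem_posRoots_iff (x : W) (i : B) :
    R.act x (R.α i) ∈ R.posRoots ↔ cs.length x < cs.length (x * cs.simple i) := by
  have key : ∀ y : W, R.act y (R.α i) ∈ R.posRoots →
      cs.length y < cs.length (y * cs.simple i) := fun y hy => by
    have := R.length_lt_of_act_inv_pos (w := y⁻¹) (R.simple_mem_posRoots i)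
      (R.isReflectionIn_simple i) (by rwa [inv_inv])
    rw [← cs.length_inv (_ * _)] at this
    simpa using this
  refine ⟨key x, fun h => ?_⟩
  rcases R.posRoots_or_neg (R.act_mem_roots x (R.simple_mem_roots i)) with h1 | h1
  · exact h1
  · have := key (x * cs.simple i) (by rwa [act_mul_apply, act_simple_self, map_neg])
    rw [cs.simple_mul_simple_cancel_right] at this
    omega

/-- The strong exchange property. -/
theorem strong_exchange (R : CoxeterRootSystem cs V) (ω : List B) {t : W} (ht : cs.IsReflection t)
    (hlt : cs.length (t * cs.wordProd ω) < cs.length (cs.wordProd ω)) :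
    ∃ j < ω.length, t * cs.wordProd ω = cs.wordProd (ω.eraseIdx j) := by
  obtain ⟨β, hβ, h⟩ := R.exists_posRoot_of_isReflection ht
  rcases R.posRoots_or_neg (R.act_mem_roots (cs.wordProd ω)⁻¹ hβ.1) with h1 | h1
  · have := R.length_lt_of_act_inv_pos hβ h h1
    omega
  · exact R.exists_eraseIdx_of_act_inv_neg ω hβ h h1

end CoxeterRootSystem

/-! ### Bruhat order and multiplication by simple reflections -/

namespace CoxeterSystem

variable {B W : Type*} [Group W] {M : CoxeterMatrix B} (cs : CoxeterSystem M W)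

/-- The longer one of `x` and `s x`. -/
noncomputable def leftMax (i : B) (x : W) : W :=
  if cs.length x < cs.length (cs.simple i * x) then cs.simple i * x else x

/-- The shorter one of `x` and `s x`. -/
noncomputable def leftMin (i : B) (x : W) : W :=
  if cs.length x < cs.length (cs.simple i * x) then x else cs.simple i * x

/-- The longer one of `x` and `x s`. -/
noncomputable def rightMax (x : W) (i : B) : W :=
  if cs.length x < cs.length (x * cs.simple i) then x * cs.simple i else x

variable {cs}

theorem leftMax_of_lt {i : B} {x : W} (h : cs.length x < cs.length (cs.simple i * x)) :
    cs.leftMax i x = cs.simple i * x := if_pos h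

theorem leftMax_of_gt {i : B} {x : W} (h : cs.length (cs.simple i * x) < cs.length x) :
    cs.leftMax i x = x := if_neg h.not_gt

theorem leftMin_of_lt {i : B} {x : W} (h : cs.length x < cs.length (cs.simple i * x)) :
    cs.leftMin i x = x := if_pos h

theorem leftMin_of_gt {i : B} {x : W} (h : cs.length (cs.simple i * x) < cs.length x) :
    cs.leftMin i x = cs.simple i * x := if_neg h.not_gt

theorem rightMax_of_lt {i : B} {x : W} (h : cs.length x < cs.length (x * cs.simple i)) :
    cs.rightMax x i = x * cs.simple i := if_pos h

theorem rightMax_of_gt {i : B} {x : W} (h : cs.length (x * cs.simple i) < cs.length x) :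
    cs.rightMax x i = x := if_neg h.not_gt

variable (cs)

theorem length_lt_or_gt_simple_mul (i : B) (x : W) :
    cs.length x < cs.length (cs.simple i * x) ∨ cs.length (cs.simple i * x) < cs.length x :=
  (cs.length_simple_mul_ne x i).symm.lt_or_gt

theorem length_lt_or_gt_mul_simple (x : W) (i : B) :
    cs.length x < cs.length (x * cs.simple i) ∨ cs.length (x * cs.simple i) < cs.length x :=
  (cs.length_mul_simple_ne x i).symm.lt_or_gt

theorem BruhatLE.refl (x : W) : cs.BruhatLE x x := Relation.ReflTransGen.refl

variable {cs}

theorem BruhatLE.trans {x y z : W} (h : cs.BruhatLE x y) (h' : cs.BruhatLE y z) :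
    cs.BruhatLE x z := Relation.ReflTransGen.trans h h'

theorem BruhatCover.le {x y : W} (h : cs.BruhatCover x y) : cs.BruhatLE x y :=
  Relation.ReflTransGen.single h

theorem BruhatLE.length_le {x y : W} (h : cs.BruhatLE x y) : cs.length x ≤ cs.length y := by
  induction h with
  | refl => rfl
  | tail _ h ih =>
    obtain ⟨t, _, _, h⟩ := h
    omega

theorem bruhatCover_simple_mul {x : W} {i : B}
    (h : cs.length x < cs.length (cs.simple i * x)) : cs.BruhatCover x (cs.simple i * x) :=
  ⟨cs.simple i, cs.isReflection_simple i, rfl, by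
    rcases cs.length_simple_mul x i with h' | h' <;> omega⟩

variable (cs)

theorem bruhatLE_leftMax (i : B) (x : W) : cs.BruhatLE x (cs.leftMax i x) := by
  rcases cs.length_lt_or_gt_simple_mul i x with h | h
  · rw [leftMax_of_lt h]; exact (bruhatCover_simple_mul h).le
  · rw [leftMax_of_gt h]; exact .refl cs x

theorem leftMin_bruhatLE (i : B) (x : W) : cs.BruhatLE (cs.leftMin i x) x := by
  rcases cs.length_lt_or_gt_simple_mul i x with h | h
  · rw [leftMin_of_lt h]; exact .refl cs x
  · rw [leftMin_of_gt h]
    have := bruhatCover_simple_mul (cs := cs) (x := cs.simple i * x) (i := i)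
    rw [cs.simple_mul_simple_cancel_left] at this
    exact (this h).le

theorem simple_mul_bruhatLE_leftMax (i : B) (x : W) :
    cs.BruhatLE (cs.simple i * x) (cs.leftMax i x) := by
  rcases cs.length_lt_or_gt_simple_mul i x with h | h
  · rw [leftMax_of_lt h]; exact .refl cs _
  · rw [leftMax_of_gt h, ← leftMin_of_gt h]; exact cs.leftMin_bruhatLE i x

theorem leftMin_leftMax (i : B) (x : W) : cs.leftMin i (cs.leftMax i x) = cs.leftMin i x := by
  rcases cs.length_lt_or_gt_simple_mul i x with h | h
  · rw [leftMax_of_lt h, leftMin_of_lt h, leftMin_of_gt, cs.simple_mul_simple_cancel_left]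
    rwa [cs.simple_mul_simple_cancel_left]
  · rw [leftMax_of_gt h]

theorem leftMax_leftMax (i : B) (x : W) : cs.leftMax i (cs.leftMax i x) = cs.leftMax i x := by
  rcases cs.length_lt_or_gt_simple_mul i x with h | h
  · rw [leftMax_of_lt h, leftMax_of_gt]
    rwa [cs.simple_mul_simple_cancel_left]
  · rw [leftMax_of_gt h, leftMax_of_gt h]

variable {cs}

/-- Multiplying both sides of a Bruhat cover by a simple reflection gives a cover again as soon as
the lengths permit it. -/
theorem BruhatCover.simple_mul {x y : W} (h : cs.BruhatCover x y) (i : B)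
    (hl : cs.length (cs.simple i * y) = cs.length (cs.simple i * x) + 1) :
    cs.BruhatCover (cs.simple i * x) (cs.simple i * y) := by
  obtain ⟨t, ht, rfl, _⟩ := h
  refine ⟨_, ht.conj (cs.simple i), ?_, hl⟩
  rw [cs.inv_simple, mul_assoc, cs.simple_mul_simple_cancel_left, mul_assoc]

end CoxeterSystem

namespace CoxeterRootSystem

open CoxeterSystem

variable {B W : Type*} [Group W] {M : CoxeterMatrix B} {cs : CoxeterSystem M W}
  {V : Type*} [NormedAddCommGroup V] [InnerProductSpace ℝ V]

/-- Otherwise `y` has a reduced word starting with `s`, and strong exchange obtains `x` by deleting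
a letter. Deleting the first gives `y = s x`; deleting a later one leaves `x` with `s` as a left
descent. -/
theorem length_lt_simple_mul_of_bruhatCover (R : CoxeterRootSystem cs V) {x y : W}
    (h : cs.BruhatCover x y) {i : B} (hx : cs.length x < cs.length (cs.simple i * x))
    (hne : y ≠ cs.simple i * x) : cs.length y < cs.length (cs.simple i * y) := by
  refine (cs.length_lt_or_gt_simple_mul i y).resolve_right fun hy => ?_
  obtain ⟨t, ht, rfl, hl⟩ := h
  obtain ⟨ω, hω, hωy⟩ := cs.exists_isReduced (cs.simple i * (t * x))
  have hyω : t * x = cs.wordProd (i :: ω) := by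
    rw [cs.wordProd_cons, ← hωy, cs.simple_mul_simple_cancel_left]
  have htt : t * (t * x) = x := by rw [← mul_assoc, ht.mul_self, one_mul]
  have hlen := cs.length_simple_mul (t * x) i
  have hωl := hω.eq
  rw [← hωy] at hωl
  obtain ⟨j, hj, hjx⟩ := R.strong_exchange (i :: ω) ht (by rw [← hyω, htt]; omega)
  rw [← hyω, htt] at hjx
  cases j with
  | zero =>
    apply hne
    rw [hyω, hjx, List.eraseIdx_cons_zero, cs.wordProd_cons]
  | succ j =>
    rw [List.eraseIdx_cons_succ, cs.wordProd_cons] at hjx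
    have h1 := cs.length_wordProd_le (ω.eraseIdx j)
    rw [List.length_eraseIdx_of_lt (by simpa using hj)] at h1
    rw [hjx, cs.simple_mul_simple_cancel_left, ← hjx] at hx
    omega

/-- Enough for a cover `y ≺ z`: if `s` lengthens `y` and `z ≠ s y`, it lengthens `z` too, and `s y ≺
s z` is again a cover. -/
theorem leftMax_mono (R : CoxeterRootSystem cs V) {x y : W} (h : cs.BruhatLE x y) (i : B) :
    cs.BruhatLE (cs.leftMax i x) (cs.leftMax i y) := by
  induction h with
  | refl => exact .refl cs _
  | @tail y z _ h ih =>
    refine ih.trans ?_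
    rcases cs.length_lt_or_gt_simple_mul i y with hy | hy
    · by_cases hz : z = cs.simple i * y
      · rw [leftMax_of_lt hy, ← hz]; exact cs.bruhatLE_leftMax i z
      · have hz' := R.length_lt_simple_mul_of_bruhatCover h hy hz
        rw [leftMax_of_lt hy, leftMax_of_lt hz']
        refine (h.simple_mul i ?_).le
        obtain ⟨t, _, _, hl⟩ := h
        rcases cs.length_simple_mul y i with h1 | h1 <;>
          rcases cs.length_simple_mul z i with h2 | h2 <;> omega
    · rw [leftMax_of_gt hy]
      exact h.le.trans (cs.bruhatLE_leftMax i z)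

theorem leftMin_mono (R : CoxeterRootSystem cs V) {x y : W} (h : cs.BruhatLE x y) (i : B) :
    cs.BruhatLE (cs.leftMin i x) (cs.leftMin i y) := by
  induction h with
  | refl => exact .refl cs _
  | @tail y z _ h ih =>
    refine ih.trans ?_
    rcases cs.length_lt_or_gt_simple_mul i z with hz | hz
    · rw [leftMin_of_lt hz]
      exact (cs.leftMin_bruhatLE i y).trans h.le
    · rcases cs.length_lt_or_gt_simple_mul i y with hy | hy
      · have : z = cs.simple i * y := by
          by_contra hne
          exact (R.length_lt_simple_mul_of_bruhatCover h hy hne).not_gt hz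
        rw [leftMin_of_lt hy, leftMin_of_gt hz, this, cs.simple_mul_simple_cancel_left]
        exact .refl cs _
      · rw [leftMin_of_gt hy, leftMin_of_gt hz]
        refine (h.simple_mul i ?_).le
        obtain ⟨t, _, _, hl⟩ := h
        rcases cs.length_simple_mul y i with h1 | h1 <;>
          rcases cs.length_simple_mul z i with h2 | h2 <;> omega

/-- The left and right Demazure actions of simple reflections commute. -/
theorem leftMax_rightMax (R : CoxeterRootSystem cs V) (i j : B) (x : W) :
    cs.leftMax i (cs.rightMax x j) = cs.rightMax (cs.leftMax i x) j := by
  have a1 := cs.length_simple_mul x i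
  have a2 := cs.length_mul_simple x j
  have a3 := cs.length_simple_mul (x * cs.simple j) i
  have a4 := cs.length_mul_simple (cs.simple i * x) j
  rw [mul_assoc] at a4
  rcases cs.length_lt_or_gt_simple_mul i x with hl | hl <;>
    rcases cs.length_lt_or_gt_mul_simple x j with hr | hr
  · rw [leftMax_of_lt hl, rightMax_of_lt hr]
    rcases cs.length_lt_or_gt_simple_mul i (x * cs.simple j) with h | h
    · rw [leftMax_of_lt h, rightMax_of_lt (by rw [mul_assoc]; omega), mul_assoc]
    -- The only delicate case. Exchange deletes a letter from a reduced word of `x` followed by `j`;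
    -- a deletion inside `x` would make `s x` shorter than `x`, so the last letter goes.
    · have heq : cs.simple i * x = x * cs.simple j := by
        obtain ⟨ω, hω, rfl⟩ := cs.exists_isReduced x
        have hωl := hω.eq
        rw [← cs.wordProd_concat] at h ⊢
        obtain ⟨k, hk, hkx⟩ := R.strong_exchange (ω.concat j) (cs.isReflection_simple i) h
        rw [List.concat_eq_append] at hk hkx
        rcases lt_or_ge k ω.length with hk' | hk'
        · rw [List.eraseIdx_append_of_lt_length hk', cs.wordProd_append, cs.wordProd_append,
            ← mul_assoc] at hkx
          have h1 := cs.length_wordProd_le (ω.eraseIdx k)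
          rw [List.length_eraseIdx_of_lt hk', ← mul_right_cancel hkx] at h1
          omega
        · have hkeq : k = ω.length := by simp at hk; omega
          rw [hkeq, List.eraseIdx_append_of_length_le le_rfl] at hkx
          simp only [Nat.sub_self, List.eraseIdx_cons_zero, List.append_nil] at hkx
          rw [List.concat_eq_append, ← hkx, cs.simple_mul_simple_cancel_left]
      rw [leftMax_of_gt h, heq, rightMax_of_gt]
      rw [cs.simple_mul_simple_cancel_right]; exact hr
  · rw [leftMax_of_lt hl, rightMax_of_gt hr, leftMax_of_lt hl, rightMax_of_gt]
    rw [mul_assoc]; omega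
  · rw [leftMax_of_gt hl, rightMax_of_lt hr, leftMax_of_gt]
    omega
  · rw [leftMax_of_gt hl, rightMax_of_gt hr, leftMax_of_gt hl]

/-! ### Demazure products -/

theorem foldl_demazure_eq (R : CoxeterRootSystem cs V) (L : List B) :
    R.demazure L = L.foldl cs.rightMax 1 := by
  unfold demazure
  congr 1
  funext x i
  simp only [rightMax, R.act_simple_mem_posRoots_iff]

theorem demazure_nil (R : CoxeterRootSystem cs V) : R.demazure [] = 1 := rfl

/-- The definition grows on the right, but the algorithm removes letters from the left of the
suffix; commutation of the two actions gives the left recursion. -/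
theorem demazure_cons (R : CoxeterRootSystem cs V) (i : B) (L : List B) :
    R.demazure (i :: L) = cs.leftMax i (R.demazure L) := by
  rw [foldl_demazure_eq, foldl_demazure_eq, List.foldl_cons]
  have h1 : cs.rightMax 1 i = cs.leftMax i 1 := by simp [leftMax, rightMax]
  rw [h1]
  generalize (1 : W) = x
  induction L generalizing x with
  | nil => rfl
  | cons j L ih => rw [List.foldl_cons, List.foldl_cons, ← R.leftMax_rightMax, ih]

theorem bruhatLE_demazure_of_sublist (R : CoxeterRootSystem cs V) {L L' : List B}
    (h : L.Sublist L') : cs.BruhatLE (cs.wordProd L) (R.demazure L') := by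
  induction h with
  | slnil => rw [cs.wordProd_nil, demazure_nil]; exact .refl cs _
  | cons i _ ih => rw [demazure_cons]; exact ih.trans (cs.bruhatLE_leftMax i _)
  | cons_cons i _ ih =>
    rw [demazure_cons, cs.wordProd_cons]
    exact (cs.simple_mul_bruhatLE_leftMax i _).trans (R.leftMax_mono ih i)

end CoxeterRootSystem

/-! ### Right weak order as additivity of lengths -/

namespace CoxeterSystem

variable {B W : Type*} [Group W] {M : CoxeterMatrix B} {cs : CoxeterSystem M W}

theorem rightWeakLE_iff {x w : W} :
    cs.RightWeakLE x w ↔ cs.length x + cs.length (x⁻¹ * w) = cs.length w := by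
  constructor
  · intro h
    induction h with
    | refl => simp
    | @tail y z _ h ih =>
      obtain ⟨i, rfl, hl⟩ := h
      have h1 := cs.length_mul_le (x⁻¹ * y) (cs.simple i)
      have h2 := cs.length_mul_le x (x⁻¹ * (y * cs.simple i))
      rw [cs.length_simple, mul_assoc] at h1
      rw [mul_inv_cancel_left] at h2
      omega
  · intro h
    obtain ⟨ω, hω, hωw⟩ := cs.exists_isReduced (x⁻¹ * w)
    rw [inv_mul_eq_iff_eq_mul] at hωw
    subst hωw
    rw [inv_mul_cancel_left, hω.eq] at h
    -- Reducedness of the remaining word is implied by the length equation `h`, so the induction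
    -- carries only `h`.
    clear hω
    induction ω generalizing x with
    | nil => rw [cs.wordProd_nil, mul_one]; exact Relation.ReflTransGen.refl
    | cons i ω ih =>
      rw [cs.wordProd_cons, ← mul_assoc] at h ⊢
      rw [List.length_cons] at h
      have h1 := cs.length_mul_le (x * cs.simple i) (cs.wordProd ω)
      have h2 := cs.length_wordProd_le ω
      have h3 := cs.length_mul_simple x i
      have hl : cs.length (x * cs.simple i) = cs.length x + 1 := by omega
      exact Relation.ReflTransGen.head ⟨i, rfl, hl⟩ (ih (by omega))

theorem length_lt_mul_simple_of_leftDescent {x u : W} {i : B}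
    (h : cs.length x + cs.length u = cs.length (x * u))
    (hi : cs.length (cs.simple i * u) < cs.length u) :
    cs.length x < cs.length (x * cs.simple i) := by
  have h1 := cs.length_mul_le (x * cs.simple i) (cs.simple i * u)
  rw [mul_assoc, cs.simple_mul_simple_cancel_left] at h1
  omega

end CoxeterSystem

/-! ### `E⁺` and the decision rule under removal of one letter -/

namespace CoxeterRootSystem

open CoxeterSystem

variable {B W : Type*} [Group W] {M : CoxeterMatrix B} {cs : CoxeterSystem M W}
  {V : Type*} [NormedAddCommGroup V] [InnerProductSpace ℝ V]

theorem bruhatLE_of_bruhatLE_leftMax (R : CoxeterRootSystem cs V) {i : B} {u y : W}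
    (h : cs.BruhatLE u (cs.leftMax i y)) (hi : cs.length u < cs.length (cs.simple i * u)) :
    cs.BruhatLE u y := by
  have := R.leftMin_mono h i
  rw [leftMin_leftMax, leftMin_of_lt hi] at this
  exact this.trans (cs.leftMin_bruhatLE i y)

theorem simple_mul_bruhatLE_of_bruhatLE_leftMax (R : CoxeterRootSystem cs V) {i : B} {u y : W}
    (h : cs.BruhatLE u (cs.leftMax i y)) (hi : cs.length (cs.simple i * u) < cs.length u) :
    cs.BruhatLE (cs.simple i * u) y := by
  have := R.leftMin_mono h i
  rw [leftMin_leftMax, leftMin_of_gt hi] at this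
  exact this.trans (cs.leftMin_bruhatLE i y)

theorem simple_mem_Eplus (R : CoxeterRootSystem cs V) {i : B} {u y : W}
    (h : cs.BruhatLE u (cs.leftMax i y)) (hi : cs.length u < cs.length (cs.simple i * u)) :
    R.α i ∈ R.Eplus u (cs.leftMax i y) := by
  refine ⟨R.simple_mem_posRoots i, cs.simple i, R.isReflectionIn_simple i,
    bruhatCover_simple_mul hi, ?_⟩
  have := R.leftMax_mono h i
  rwa [leftMax_leftMax, leftMax_of_lt hi] at this

theorem Eplus_mono (R : CoxeterRootSystem cs V) {x y z : W} (h : cs.BruhatLE y z) :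
    R.Eplus x y ⊆ R.Eplus x z :=
  fun _ ⟨hβ, r, hr, hc, hle⟩ => ⟨hβ, r, hr, hc, hle.trans h⟩

theorem bruhatLE_of_simple_mem_Eplus (R : CoxeterRootSystem cs V) {i : B} {u y : W}
    (h : R.α i ∈ R.Eplus (cs.simple i * u) y) : cs.BruhatLE u y := by
  obtain ⟨_, r, hr, _, hle⟩ := h
  rwa [hr.unique (R.isReflectionIn_simple i), cs.simple_mul_simple_cancel_left] at hle

/-- Multiplying the cover `s u ≺ r s u` by `s` gives `u ≺ (s r s) u`, and `s r s` is the reflection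
in `s β`. -/
theorem act_simple_mem_Eplus (R : CoxeterRootSystem cs V) {i : B} {u y : W} {β : V}
    (hi : cs.length (cs.simple i * u) < cs.length u)
    (h : β ∈ R.Eplus (cs.simple i * u) y) (hne : β ≠ R.α i) :
    R.act (cs.simple i) β ∈ R.Eplus u (cs.leftMax i y) := by
  obtain ⟨hβ, r, hr, hc, hle⟩ := h
  have hconj := hr.conj (cs.simple i)
  have hmul : cs.simple i * r * (cs.simple i)⁻¹ * u = cs.simple i * (r * (cs.simple i * u)) := by
    rw [cs.inv_simple]; simp only [mul_assoc]
  refine ⟨R.act_simple_mem_posRoots hβ hne, _, hconj, ?_, ?_⟩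
  -- Equality would mean `r = s`, so `s β = -β`, whereas `s` keeps `β ≠ α_s` positive.
  · have hri : r * (cs.simple i * u) ≠ cs.simple i * (cs.simple i * u) := fun heq => by
      have hrs := mul_right_cancel (a := r) heq
      rw [hrs] at hr
      have h1 := hr.act_self
      rw [act_simple_apply] at h1
      have h2 := R.act_simple_mem_posRoots hβ hne
      rw [hr.act_self] at h2
      exact R.neg_notMem_posRoots hβ h2
    have hlt := R.length_lt_simple_mul_of_bruhatCover (i := i) hc
      (by rwa [cs.simple_mul_simple_cancel_left]) hri
    have h1 := hc.simple_mul i (by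
      obtain ⟨_, _, _, hl⟩ := hc
      have h1 := cs.length_simple_mul (r * (cs.simple i * u)) i
      have h2 := cs.length_simple_mul u i
      rw [cs.simple_mul_simple_cancel_left]
      omega)
    rwa [cs.simple_mul_simple_cancel_left, ← hmul] at h1
  · rw [hmul]
    exact (cs.simple_mul_bruhatLE_leftMax i _).trans (R.leftMax_mono hle i)

/-- Pulling a property of the roots in `E⁺` through one step at which the letter is used. -/
theorem forall_Eplus_simple_mul (R : CoxeterRootSystem cs V) {P : V → Prop} {i : B} {x u y : W}
    (hi : cs.length (cs.simple i * u) < cs.length u)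
    (h : ∀ β ∈ R.Eplus u (cs.leftMax i y), P (R.act x β))
    (hs : cs.BruhatLE u y → P (-R.act x (R.α i))) :
    ∀ β ∈ R.Eplus (cs.simple i * u) y, P (R.act (x * cs.simple i) β) := by
  intro β hβ
  rw [act_mul_apply]
  by_cases hne : β = R.α i
  · subst hne
    rw [act_simple_self, map_neg]
    exact hs (R.bruhatLE_of_simple_mem_Eplus hβ)
  · exact h _ (R.act_simple_mem_Eplus hi hβ hne)

open Classical in
-- For a positive root `x α_s`, the weak order test `x s ≤ w` says that `s` is a left descent of
-- `u`; conversely a left descent makes `x α_s` positive. The hypothesis `hf` rules out condition 4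
-- when `s` is not a descent.
theorem antigreedyStep_eq (R : CoxeterRootSystem cs V) {m : ℕ} (Q : Fin m → B) {w x u : W}
    (f : V →ₗ[ℝ] ℝ) (I : Finset (Fin m)) (k : Fin m) (hw : w = x * u)
    (hadd : cs.length x + cs.length u = cs.length w)
    (hf : cs.length u < cs.length (cs.simple (Q k) * u) → 0 ≤ f (R.act x (R.α (Q k)))) :
    R.antigreedyStep Q w f (x, I) k =
      if cs.length (cs.simple (Q k) * u) < cs.length u ∧
          (f (R.act x (R.α (Q k))) ≤ 0 ∨ ¬ cs.BruhatLE u (R.demazure (subword Q (Finset.Ioi k))))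
      then (x * cs.simple (Q k), I) else (x, insert k I) := by
  subst hw
  have hdesc : R.act x (R.α (Q k)) ∈ R.posRoots →
      (cs.RightWeakLE (x * cs.simple (Q k)) (x * u) ↔
        cs.length (cs.simple (Q k) * u) < cs.length u) := fun hpos => by
    rw [R.act_simple_mem_posRoots_iff] at hpos
    rw [rightWeakLE_iff, mul_inv_rev, cs.inv_simple, mul_assoc, inv_mul_cancel_left]
    have h1 := cs.length_mul_simple x (Q k)
    have h2 := cs.length_simple_mul u (Q k)
    omega
  have hpos : cs.length (cs.simple (Q k) * u) < cs.length u → R.act x (R.α (Q k)) ∈ R.posRoots :=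
    fun h => (R.act_simple_mem_posRoots_iff _ _).mpr (length_lt_mul_simple_of_leftDescent hadd h)
  unfold antigreedyStep antigreedyCondition
  simp only [inv_mul_cancel_left]
  rcases cs.length_lt_or_gt_simple_mul (Q k) u with h | h
  · have h0 := hf h
    have hn : ¬ cs.length (cs.simple (Q k) * u) < cs.length u := h.not_gt
    by_cases hp : R.act x (R.α (Q k)) ∈ R.posRoots
    · have := (hdesc hp).not.mpr hn
      by_cases hz : f (R.act x (R.α (Q k))) = 0 <;> simp [hn, hp, this, hz, h0.not_gt]
    · by_cases hz : f (R.act x (R.α (Q k))) = 0 <;> simp [hn, hp, hz, h0.not_gt]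
  · have hp := hpos h
    have := (hdesc hp).mpr h
    rcases lt_trichotomy (f (R.act x (R.α (Q k)))) 0 with hz | hz | hz
    · simp [h, hz, hz.le]
    · simp [h, hz, hp, this]
    · by_cases hb : cs.BruhatLE u (R.demazure (subword Q (Finset.Ioi k))) <;>
        simp [h, hz.not_gt, hz.ne', hz.not_ge, hp, this, hb]

end CoxeterRootSystem

/-! ### Subwords and the left fold over positions -/

section subword

variable {B : Type*} {m : ℕ} (Q : Fin m → B)

theorem filter_finRange_eq {X : Finset (Fin m)} {L : List (Fin m)} (hL : L.SortedLT)
    (h : ∀ j, j ∈ L ↔ j ∈ X) : (List.finRange m).filter (fun k => k ∈ X) = L := by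
  refine List.SortedLT.eq_of_mem_iff ?_ hL (by simp [h])
  exact ((List.sortedLT_finRange m).pairwise.filter _).sortedLT

theorem subword_empty : subword Q ∅ = [] := by simp [subword]

theorem subword_insert_of_lt {X : Finset (Fin m)} {k : Fin m} (h : ∀ j ∈ X, j < k) :
    subword Q (insert k X) = subword Q X ++ [Q k] := by
  have hX := ((List.sortedLT_finRange m).pairwise.filter (fun k => decide (k ∈ X)))
  unfold subword
  rw [filter_finRange_eq (L := (List.finRange m).filter (fun k => k ∈ X) ++ [k])]
  · simp
  · refine List.Pairwise.sortedLT (List.pairwise_append.mpr ⟨hX, by simp, ?_⟩)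
    simpa using h
  · simp [or_comm]

theorem subword_insert_of_gt {X : Finset (Fin m)} {k : Fin m} (h : ∀ j ∈ X, k < j) :
    subword Q (insert k X) = Q k :: subword Q X := by
  have hX := ((List.sortedLT_finRange m).pairwise.filter (fun k => decide (k ∈ X)))
  unfold subword
  rw [filter_finRange_eq (L := k :: (List.finRange m).filter (fun k => k ∈ X))]
  · simp
  · refine List.Pairwise.sortedLT (List.pairwise_cons.mpr ⟨?_, hX⟩)
    simpa using h
  · simp

theorem length_subword (X : Finset (Fin m)) : (subword Q X).length = X.card := by
  have h : ((List.finRange m).filter (fun k => k ∈ X)).toFinset = X := by ext; simp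
  rw [subword, List.length_map, ← List.toFinset_card_of_nodup ((List.nodup_finRange m).filter _), h]

theorem subword_univ : subword Q Finset.univ = List.ofFn Q := by
  simp [subword, List.ofFn_eq_map]

theorem subword_sublist (X : Finset (Fin m)) : (subword Q X).Sublist (List.ofFn Q) := by
  rw [List.ofFn_eq_map]
  exact List.filter_sublist.map Q

theorem subword_Ici (k : Fin m) : subword Q (Finset.Ici k) = Q k :: subword Q (Finset.Ioi k) := by
  rw [← subword_insert_of_gt Q (by simp), Finset.Ioi_insert]

end subword

/-- Induction along a left fold over all elements of `Fin m`. -/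
theorem List.foldl_finRange_induction {m : ℕ} {σ : Type*} (step : σ → Fin m → σ) (s : σ)
    (P : ℕ → σ → Prop) (h0 : P 0 s) (hs : ∀ (k : Fin m) (t : σ), P k t → P (k + 1) (step t k)) :
    P m ((List.finRange m).foldl step s) := by
  have key : ∀ n ≤ m, P n (((List.finRange m).take n).foldl step s) := by
    intro n
    induction n with
    | zero => simpa using h0
    | succ n ih =>
      intro hn
      rw [List.take_add_one, List.getElem?_eq_getElem (by simpa using hn)]
      simpa [List.foldl_append] using hs ⟨n, hn⟩ _ (ih (by omega))
  have h := key m le_rfl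
  rwa [List.take_of_length_le (by simp)] at h

/-! ### The invariant of the scan -/

namespace CoxeterRootSystem

open CoxeterSystem

variable {B W : Type*} [Group W] {M : CoxeterMatrix B} {cs : CoxeterSystem M W}
  {V : Type*} [NormedAddCommGroup V] [InnerProductSpace ℝ V]

/-- The property of a vector asserted for the values of the root function. -/
def NonnegAwayFrom (R : CoxeterRootSystem cs V) (f : V →ₗ[ℝ] ℝ) (E : Set V) (γ : V) : Prop :=
  0 ≤ f γ ∧ (f γ = 0 → γ ∈ E ∨ γ ∈ R.negRoots)

/-- The invariant of the algorithm after the letters at the positions below `k` were scanned: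
`S.1` is the current group element, `S.2` the current set of positions, and the roots in
`E⁺` for the remaining suffix have the property `P`. -/
structure ScanInvariant (R : CoxeterRootSystem cs V) {m : ℕ} (Q : Fin m → B) (w : W)
    (P : V → Prop) (k : ℕ) (S : W × Finset (Fin m)) : Prop where
  subset : S.2 ⊆ Finset.univ.filter (fun j => j.val < k)
  wordProd_eq : cs.wordProd (subword Q (Finset.univ.filter (fun j => j.val < k) \ S.2)) = S.1
  length_eq : cs.length S.1 = (Finset.univ.filter (fun j : Fin m => j.val < k) \ S.2).card
  length_add : cs.length S.1 + cs.length (S.1⁻¹ * w) = cs.length w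
  le_demazure : cs.BruhatLE (S.1⁻¹ * w)
    (R.demazure (subword Q (Finset.univ.filter (fun j => k ≤ j.val))))
  forall_Eplus : ∀ β ∈ R.Eplus (S.1⁻¹ * w)
    (R.demazure (subword Q (Finset.univ.filter (fun j => k ≤ j.val)))), P (R.act S.1 β)
  forall_rootFn : ∀ i ∈ S.2, P (R.rootFn Q S.2 i)

theorem ScanInvariant.zero {R : CoxeterRootSystem cs V} {m : ℕ} {Q : Fin m → B} {w : W}
    {P : V → Prop} (hw : cs.BruhatLE w (R.demazure (List.ofFn Q)))
    (hP : ∀ β ∈ R.Eplus w (R.demazure (List.ofFn Q)), P β) :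
    R.ScanInvariant Q w P 0 (1, ∅) where
  subset := by simp
  wordProd_eq := by simp [subword_empty]
  length_eq := by simp
  length_add := by simp
  le_demazure := by simpa [subword_univ] using hw
  forall_Eplus := by simpa [subword_univ, act_one_apply] using hP
  forall_rootFn := by simp

theorem ScanInvariant.step {R : CoxeterRootSystem cs V} {m : ℕ} {Q : Fin m → B} {w : W}
    {f : V →ₗ[ℝ] ℝ} {E : Set V} {k : Fin m} {S : W × Finset (Fin m)}
    (h : R.ScanInvariant Q w (R.NonnegAwayFrom f E) k S) :
    R.ScanInvariant Q w (R.NonnegAwayFrom f E) (k + 1) (R.antigreedyStep Q w f S k) := by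
  obtain ⟨x, I⟩ := S
  obtain ⟨u, rfl⟩ : ∃ u, w = x * u := ⟨x⁻¹ * w, by rw [mul_inv_cancel_left]⟩
  have hlt : Finset.univ.filter (fun j : Fin m => j.val < k) = Finset.Iio k := by
    ext j; simp
  have hlt' : Finset.univ.filter (fun j : Fin m => j.val < k + 1) = insert k (Finset.Iio k) := by
    ext j
    simp only [Finset.mem_filter, Finset.mem_univ, true_and, Finset.mem_insert, Finset.mem_Iio,
      Fin.ext_iff, Fin.lt_def]
    omega
  have hge : Finset.univ.filter (fun j : Fin m => k ≤ j.val) = Finset.Ici k := by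
    ext j; simp
  have hge' : Finset.univ.filter (fun j : Fin m => k + 1 ≤ j.val) = Finset.Ioi k := by
    ext j
    simp only [Finset.mem_filter, Finset.mem_univ, true_and, Finset.mem_Ioi, Fin.lt_def]
    omega
  obtain ⟨hsub, hprod, hlen, hadd, hle, hE, hI⟩ := h
  simp only [hlt, hge, inv_mul_cancel_left, subword_Ici, demazure_cons]
    at hsub hprod hlen hadd hle hE hI
  have hkI : k ∉ I := fun hk => by simpa using hsub hk
  rw [R.antigreedyStep_eq Q f I k rfl hadd fun hi => (hE _ (R.simple_mem_Eplus hle hi)).1]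
  -- The root function at `i` sees only positions below `i`, so inserting `k` changes no value
  -- already fixed.
  have hroot : ∀ J : Finset (Fin m), (∀ j, j < k → (j ∈ J ↔ j ∈ I)) → ∀ i ∈ Finset.Iic k,
      R.rootFn Q J i = R.rootFn Q I i := fun J hJ i hi => by
    unfold rootFn
    congr 4
    ext j
    simp only [Finset.mem_sdiff, Finset.mem_Iio, Finset.mem_Iic] at hi ⊢
    exact and_congr_right fun hj => (hJ j (hj.trans_le hi)).not
  split_ifs with hc
  · obtain ⟨hi, hc⟩ := hc
    have hinv : (x * cs.simple (Q k))⁻¹ * (x * u) = cs.simple (Q k) * u := by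
      rw [mul_inv_rev, cs.inv_simple, mul_assoc, inv_mul_cancel_left]
    have hsd : insert k (Finset.Iio k) \ I = insert k (Finset.Iio k \ I) :=
      Finset.insert_sdiff_of_notMem _ hkI
    have hx := length_lt_mul_simple_of_leftDescent hadd hi
    have hx' := cs.length_mul_simple x (Q k)
    have hu' := cs.length_simple_mul u (Q k)
    constructor
    · rw [hlt']; exact hsub.trans (Finset.subset_insert _ _)
    · rw [hlt', hsd, subword_insert_of_lt Q (fun j hj => by simp at hj; exact hj.1),
        cs.wordProd_append, cs.wordProd_singleton, hprod]
    · rw [hlt', hsd, Finset.card_insert_of_notMem (by simp), ← hlen]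
      show cs.length (x * cs.simple (Q k)) = cs.length x + 1
      omega
    · rw [hinv]
      show cs.length (x * cs.simple (Q k)) + _ = _
      omega
    · rw [hinv, hge']
      exact R.simple_mul_bruhatLE_of_bruhatLE_leftMax hle hi
    · rw [hinv, hge']
      -- Only `α_s` needs an argument. Here `u ≤ y`, so the letter was used because `f(x α_s) ≤ 0`;
      -- the vector to check is the negative root `-x α_s`.
      refine R.forall_Eplus_simple_mul hi hE fun hu => ?_
      have hpos := (R.act_simple_mem_posRoots_iff x (Q k)).mpr hx
      refine ⟨?_, fun _ => Or.inr ?_⟩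
      · rw [map_neg]
        have := hc.resolve_right (not_not.mpr hu)
        linarith
      · change - -R.act x (R.α (Q k)) ∈ R.posRoots
        rwa [neg_neg]
    · exact hI
  -- The letter is skipped. Without a descent, `u ≤ D` descends to `u ≤ y`; with one, the decision
  -- rule demands `u ≤ y`.
  · have hu : cs.BruhatLE u (R.demazure (subword Q (Finset.Ioi k))) := by
      rcases cs.length_lt_or_gt_simple_mul (Q k) u with hi | hi
      · exact R.bruhatLE_of_bruhatLE_leftMax hle hi
      · by_contra hu
        exact hc ⟨hi, Or.inr hu⟩
    have hsd : insert k (Finset.Iio k) \ insert k I = Finset.Iio k \ I := by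
      ext j
      simp only [Finset.mem_sdiff, Finset.mem_insert, Finset.mem_Iio]
      have : j < k → j ≠ k := fun h => h.ne
      tauto
    constructor
    · rw [hlt']; exact Finset.insert_subset_insert _ hsub
    · rw [hlt', hsd, hprod]
    · rw [hlt', hsd, ← hlen]
    · rw [inv_mul_cancel_left]; exact hadd
    · rw [hge', inv_mul_cancel_left]; exact hu
    · rw [hge', inv_mul_cancel_left]
      exact fun β hβ => hE β (R.Eplus_mono (cs.bruhatLE_leftMax _ _) hβ)
    · intro i hi
      have hik : i ∈ Finset.Iic k := by
        rcases Finset.mem_insert.mp hi with rfl | hi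
        · simp
        · exact Finset.mem_Iic.mpr (Finset.mem_Iio.mp (hsub hi)).le
      show R.NonnegAwayFrom f E (R.rootFn Q (insert k I) i)
      rw [hroot (insert k I) (fun j hj => by simp [hj.ne]) i hik]
      rcases Finset.mem_insert.mp hi with rfl | hi
      · rw [rootFn, hprod]
        rcases cs.length_lt_or_gt_simple_mul (Q i) u with hd | hd
        · exact hE _ (R.simple_mem_Eplus hle hd)
        · have : 0 < f (R.act x (R.α (Q i))) := by
            by_contra hf
            exact hc ⟨hd, Or.inl (not_lt.mp hf)⟩
          exact ⟨this.le, fun h0 => absurd h0 this.ne'⟩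
      · exact hI i hi

end CoxeterRootSystem

/-- All reduced words for `w` have the same length, so the complement of a larger face has no room
for a different one. -/
theorem CoxeterSystem.isSubwordFacet_of_isReduced {B W : Type*} [Group W] {M : CoxeterMatrix B}
    (cs : CoxeterSystem M W) {m : ℕ} {Q : Fin m → B} {w : W} {I : Finset (Fin m)}
    (hr : cs.IsReduced (subword Q Iᶜ)) (hw : cs.wordProd (subword Q Iᶜ) = w) :
    cs.IsSubwordFacet Q w I := by
  refine ⟨⟨Iᶜ, subset_rfl, hr, hw⟩, ?_⟩
  rintro J ⟨X, hXJ, hX, hXw⟩ hIJ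
  have h1 := hr.eq
  have h2 := hX.eq
  rw [hw, length_subword] at h1
  rw [hXw, length_subword] at h2
  have h3 : X = Iᶜ := Finset.eq_of_subset_of_card_le
    (hXJ.trans (Finset.compl_subset_compl.mpr hIJ)) (by omega)
  rw [h3] at hXJ
  exact Finset.compl_subset_compl.mp hXJ

theorem mainTheorem6 {B W V : Type*} [Finite B] [Group W] [Finite W] {M : CoxeterMatrix B}
    (cs : CoxeterSystem M W) [NormedAddCommGroup V] [InnerProductSpace ℝ V]
    (R : CoxeterRootSystem cs V) {m : ℕ} (Q : Fin m → B) (w : W)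
    (hne : (cs.subwordComplex Q w : Set (Finset (Fin m))).Nonempty)
    (f : V →ₗ[ℝ] ℝ) (hf : ∀ β ∈ R.Eplus w (R.demazure (List.ofFn Q)), 0 ≤ f β) :
    (cs.IsSubwordFacet Q w (R.antigreedyFacet Q w f) ∧
      cs.IsReduced (subword Q (R.antigreedyFacet Q w f)ᶜ) ∧
      cs.wordProd (subword Q (R.antigreedyFacet Q w f)ᶜ) = w) ∧
    (∀ i ∈ R.antigreedyFacet Q w f, 0 ≤ f (R.rootFn Q (R.antigreedyFacet Q w f) i)) ∧
    (∀ i ∈ R.antigreedyFacet Q w f,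
      f (R.rootFn Q (R.antigreedyFacet Q w f) i) = 0 →
      R.rootFn Q (R.antigreedyFacet Q w f) i ∉ R.Eplus w (R.demazure (List.ofFn Q)) →
      R.rootFn Q (R.antigreedyFacet Q w f) i ∈ R.negRoots) := by
  have hle : cs.BruhatLE w (R.demazure (List.ofFn Q)) := by
    obtain ⟨I, X, _, _, hX⟩ := hne
    rw [← hX]
    exact R.bruhatLE_demazure_of_sublist (subword_sublist Q X)
  have hinv := List.foldl_finRange_induction (R.antigreedyStep Q w f) (1, ∅)
    (R.ScanInvariant Q w (R.NonnegAwayFrom f (R.Eplus w (R.demazure (List.ofFn Q)))))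
    (.zero hle fun β hβ => ⟨hf β hβ, fun _ => Or.inl hβ⟩) (fun _ _ h => h.step)
  have hI : ((List.finRange m).foldl (R.antigreedyStep Q w f) (1, ∅)).2 =
    R.antigreedyFacet Q w f := rfl
  obtain ⟨-, hprod, hlen, hadd, hdem, -, hroot⟩ := hinv
  have hall : Finset.univ.filter (fun j : Fin m => j.val < m) = Finset.univ := by
    ext j; simp
  have hnone : Finset.univ.filter (fun j : Fin m => m ≤ j.val) = ∅ := by
    ext j; simp
  rw [hnone, subword_empty, CoxeterRootSystem.demazure_nil] at hdem
  -- The suffix is now empty, so `x⁻¹ w ≤ 1` has length zero and `x = w`.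
  have hx := hdem.length_le
  rw [cs.length_one, Nat.le_zero, cs.length_eq_zero_iff, inv_mul_eq_one] at hx
  rw [hall, ← Finset.compl_eq_univ_sdiff, hI, hx] at hprod hlen
  rw [hI] at hroot
  have hred : cs.IsReduced (subword Q (R.antigreedyFacet Q w f)ᶜ) := by
    rw [CoxeterSystem.IsReduced, hprod, hlen, length_subword]
  exact ⟨⟨cs.isSubwordFacet_of_isReduced hred hprod, hred, hprod⟩, fun i hi => (hroot i hi).1,
    fun i hi h0 hn => ((hroot i hi).2 h0).resolve_left hn⟩
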